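/- Let $\mathcal X_{\rm o}$ (observable substates), $\mathcal X_{\rm u}$ (unobservable substates) and $\mathcal A$ (actions) be finite nonempty sets, let $c:\mathcal X_{\rm o}\times\mathcal X_{\rm u}\times\mathcal A\to[0,\infty)$ be a stage cost, $p(x_{\rm o}',x_{\rm u}'\mid x_{\rm o},x_{\rm u},a)$ a stationary transition probability, $\alpha_{\rm u}$ the distribution of the initial unobservable substate, and $0\le\beta<1$ a discount factor. A policy $\pi=\{d_t\}_t\in\Pi$ chooses at time $t$ a probability distribution on $\mathcal A$ as a function of the observed history $(x_{{\rm o},0},\dots,x_{{\rm o},t},a_0,\dots,a_{t-1})$. Put $$V^{\pi}_{\alpha_{\rm u}}(x_{{\rm o},0})=\mathbb E^{\pi}\Big[\sum_{t=0}^\infty\beta^t c(x_{{\rm o},t},x_{{\rm u},t},a_t)\,\Big|\,x_{{\rm o},0}\Big],\qquad x_{{\rm u},0}\sim\alpha_{\rm u}.$$ For a probability vector $b$ on $\mathcal X_{\rm u}$ let $\bar c(x_{\rm o},b,a)=\sum_{x_{\rm u}}b(x_{\rm u})c(x_{\rm o},x_{\rm u},a)$, let $p(x_{\rm o}'\mid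 x_{\rm o},b,a)=\sum_{x_{\rm u},x_{\rm u}'}p(x_{\rm o}',x_{\rm u}'\mid x_{\rm o},x_{\rm u},a)b(x_{\rm u})$, and, when this is positive, let $$T(x_{\rm o}',x_{\rm o},b,a)(x_{\rm u}')=\frac{\sum_{x_{\rm u}}p(x_{\rm o}',x_{\rm u}'\mid x_{\rm o},x_{\rm u},a)b(x_{\rm u})}{p(x_{\rm o}'\mid x_{\rm o},b,a)}$$ be the Bayes update of $b$. Let $b_0=\alpha_{\rm u}$, and let $\mathcal B$ be the set of reachable beliefs: all $b_t$, $t\ge0$, obtained from $b_0$ and any initial $x_{{\rm o},0}\in\mathcal X_{\rm o}$ by $b_{s+1}=T(x_{{\rm o},s+1},x_{{\rm o},s},b_s,a_s)$ along actions $a_s$ and observations $x_{{\rm o},s+1}$ with $p(x_{{\rm o},s+1}\mid x_{{\rm o},s},b_s,a_s)>0$. The virtual belief model is the Markov decision process on $\mathcal X_{\rm o}$ with transition probability $\tilde p(x_{\rm o}'\mid x_{\rm o},a)=\sum_{x_{\rm u},x_{\rm u}'}p(x_{\rm o}',x_{\rm u}'\mid x_{\rm o},x_{\rm u},a)b_0(x_{\rm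 u})$ and cost $\tilde c(x_{\rm o},a)=\bar c(x_{\rm o},b_0,a)$; in it, let $\tilde V^{\pi}_{\alpha_{\rm u}}(x_{{\rm o},0})=\mathbb E^\pi\big[\sum_{t=0}^\infty\beta^t\tilde c(x_{{\rm o},t},a_t)\mid x_{{\rm o},0}\big]$. **Theorem 6 (Comparison between POMDP and Virtual Belief Models).** If the transition probability can be decomposed as $$p(x_{\rm o}',x_{\rm u}'\mid x_{\rm o},x_{\rm u},a)=p(x_{\rm o}'\mid x_{\rm o},a)\,p(x_{\rm u}'\mid x_{\rm u},a),$$ then $$\sup_{x_{{\rm o},0}}\Big|\inf_{\pi\in\Pi}V^\pi_{\alpha_{\rm u}}(x_{{\rm o},0})-\inf_{\pi\in\Pi}\tilde V^\pi_{\alpha_{\rm u}}(x_{{\rm o},0})\Big|\le\max\left\{\frac{-\underline C'}{1-\beta},\frac{\bar C'}{1-\beta}\right\},$$ where $$\bar C'=\sup_{b,b'\in\mathcal B,\;x_{\rm o},\,a}\{\bar c(x_{\rm o},b,a)-\bar c(x_{\rm o},b',a)\},\qquad \underline C'=\inf_{b,b'\in\mathcal B,\;x_{\rm o},\,a}\{\bar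 c(x_{\rm o},b,a)-\bar c(x_{\rm o},b',a)\}.$$ -/

import Mathlib

open MeasureTheory ProbabilityTheory
open scoped BigOperators

noncomputable section

/-! ### Discounted controlled Markov chains with partial observation -/

/-- The pair (state, action) of one stage of a controlled process. -/
structure Stage (S A : Type*) where
  /-- the state at that stage -/
  state : S
  /-- the action taken at that stage -/
  action : A

/-- All sets of stages are measurable; state and action spaces are finite below. -/
instance Stage.instMeasurableSpace (S A : Type*) : MeasurableSpace (Stage S A) := ⊤

instance Stage.instDiscreteMeasurableSpace (S A : Type*) :
    DiscreteMeasurableSpace (Stage S A) := ⟨fun _ => trivial⟩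

instance Stage.instFinite (S A : Type*) [Finite S] [Finite A] : Finite (Stage S A) :=
  Finite.of_injective (fun z : Stage S A => (z.state, z.action)) (by
    rintro ⟨s, a⟩ ⟨s', a'⟩ h
    simpa using h)

/-- A controlled Markov chain with state space `S`, of which the decision-maker sees at each time
only the observation `obs s`, together with a stage cost and a discount factor. -/
structure ControlledChain (S O A : Type*) where
  /-- distribution of the initial state -/
  init : PMF S
  /-- transition probabilities -/
  trans : S → A → PMF S
  /-- the observed part of the state -/
  obs : S → O
  /-- stage cost -/
  cost : S → A → ℝ
  /-- discount factor -/
  discount : ℝ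

/-- A (history-dependent, randomized) policy: the decision rule `π t` at time `t` maps the observed
history `(o_0, …, o_t; a_0, …, a_{t-1})` to a probability distribution on the actions. -/
abbrev Policy (O A : Type*) : Type _ :=
  (t : ℕ) → (Fin (t + 1) → O) → (Fin t → A) → PMF A

namespace ControlledChain

variable {S O A : Type*}

/-- Law of the stage `(s_0, a_0)` at time `0` under the policy `π`. -/
def firstStage (K : ControlledChain S O A) (π : Policy O A) : PMF (Stage S A) :=
  K.init.bind fun s =>
    (π 0 (fun _ => K.obs s) (fun i => Fin.elim0 i)).map fun a => ⟨s, a⟩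

/-- Conditional law, under the policy `π`, of the stage `(s_{n+1}, a_{n+1})` given the stages
`(s_0, a_0), …, (s_n, a_n)`: the state moves according to `K.trans s_n a_n`, and the action is then
drawn from the decision rule `π (n + 1)` at the observed history. -/
def nextStage (K : ControlledChain S O A) (π : Policy O A) (n : ℕ)
    (h : Finset.Iic n → Stage S A) : PMF (Stage S A) :=
  let z : Fin (n + 1) → Stage S A :=
    fun i => h ⟨i, Finset.mem_Iic.2 (Nat.lt_succ_iff.1 i.isLt)⟩
  (K.trans (z (Fin.last n)).state (z (Fin.last n)).action).bind fun s' =>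
    (π (n + 1) (Fin.snoc (fun i => K.obs (z i).state) (K.obs s')) (fun i => (z i).action)).map
      fun a => ⟨s', a⟩

/-- `nextStage` as a Markov kernel from histories to stages. -/
def stepKernel [Finite S] [Finite A] (K : ControlledChain S O A) (π : Policy O A) (n : ℕ) :
    Kernel (Finset.Iic n → Stage S A) (Stage S A) :=
  Kernel.ofFunOfCountable fun h => (K.nextStage π n h).toMeasure

instance instIsMarkovKernelStepKernel [Finite S] [Finite A] (K : ControlledChain S O A)
    (π : Policy O A) (n : ℕ) : IsMarkovKernel (K.stepKernel π n) :=
  ⟨fun h => PMF.toMeasure.isProbabilityMeasure (K.nextStage π n h)⟩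

/-- The law, on infinite state-action trajectories, of the process controlled by `π`
(given by the Ionescu-Tulcea theorem). -/
def law [Finite S] [Finite A] (K : ControlledChain S O A) (π : Policy O A) :
    Measure (ℕ → Stage S A) :=
  Kernel.trajMeasure (X := fun _ => Stage S A) (K.firstStage π).toMeasure (K.stepKernel π)

/-- Expected total discounted cost `𝔼^π [∑ₜ βᵗ c(s_t, a_t)]` of the policy `π`. -/
def value [Finite S] [Finite A] (K : ControlledChain S O A) (π : Policy O A) : ℝ :=
  ∫ ω, ∑' t : ℕ, K.discount ^ t * K.cost (ω t).state (ω t).action ∂(K.law π)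

/-- Infimum of the expected total discounted cost over all policies. -/
def optimalValue [Finite S] [Finite A] (K : ControlledChain S O A) : ℝ :=
  ⨅ π : Policy O A, K.value π

end ControlledChain

/-! ### Markov decision processes under local state information -/

/-- A discounted Markov decision process with observable substates `Xo`, unobservable substates
`Xu` and actions `A`. -/
structure LSIMDP (Xo Xu A : Type*) where
  /-- transition probabilities `p(x_o', x_u' | x_o, x_u, a)` -/
  trans : Xo → Xu → A → PMF (Xo × Xu)
  /-- stage cost `c(x_o, x_u, a)` -/
  cost : Xo → Xu → A → ℝ
  cost_nonneg : ∀ xo xu a, 0 ≤ cost xo xu a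
  /-- distribution `α_u = b_0` of the initial unobservable substate -/
  prior : PMF Xu
  /-- discount factor `β` -/
  discount : ℝ
  discount_nonneg : 0 ≤ discount
  discount_lt_one : discount < 1

namespace LSIMDP

variable {Xo Xu A : Type*}

/-- The transition probabilities decompose as
`p(x_o', x_u' | x_o, x_u, a) = p(x_o' | x_o, a) p(x_u' | x_u, a)`. -/
def Factorizes (M : LSIMDP Xo Xu A) : Prop :=
  ∃ (po : Xo → A → PMF Xo) (pu : Xu → A → PMF Xu),
    ∀ xo xu a xo' xu', M.trans xo xu a (xo', xu') = po xo a xo' * pu xu a xu'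

/-- The controlled process started at the observable substate `xo0`, with the initial unobservable
substate drawn from the prior; only the observable substates are observed. -/
def localModel (M : LSIMDP Xo Xu A) (xo0 : Xo) : ControlledChain (Xo × Xu) Xo A where
  init := M.prior.map fun xu => (xo0, xu)
  trans := fun x a => M.trans x.1 x.2 a
  obs := Prod.fst
  cost := fun x a => M.cost x.1 x.2 a
  discount := M.discount

section Beliefs

variable [Fintype Xu]

/-- The averaged cost `c̄(x_o, b, a) = ∑ b(x_u) c(x_o, x_u, a)` of a belief vector `b`. -/
def beliefCost (M : LSIMDP Xo Xu A) (xo : Xo) (b : Xu → ℝ) (a : A) : ℝ :=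
  ∑ xu, b xu * M.cost xo xu a

/-- The prior as a belief vector, `b_0 = α_u`. -/
def initialBelief (M : LSIMDP Xo Xu A) : Xu → ℝ := fun xu => (M.prior xu).toReal

/-- The probability `p(x_o' | x_o, b, a)` of observing `x_o'` next. -/
def obsProb (M : LSIMDP Xo Xu A) (xo' xo : Xo) (b : Xu → ℝ) (a : A) : ℝ :=
  ∑ xu, ∑ xu', (M.trans xo xu a (xo', xu')).toReal * b xu

/-- The Bayes update `T(x_o', x_o, b, a)` of the belief. -/
def beliefUpdate (M : LSIMDP Xo Xu A) (xo' xo : Xo) (b : Xu → ℝ) (a : A) : Xu → ℝ :=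
  fun xu' => (∑ xu, (M.trans xo xu a (xo', xu')).toReal * b xu) / M.obsProb xo' xo b a

/-- The pairs `(x_o, b)` of observable substate and belief that can occur: they are obtained from
`(x_{o,0}, b_0)`, for an arbitrary initial `x_{o,0}`, by finitely many actions and observations, each
observation having positive probability given the current pair and the action. -/
inductive Reachable (M : LSIMDP Xo Xu A) : Xo → (Xu → ℝ) → Prop
  | init (xo : Xo) : Reachable M xo M.initialBelief
  | step {xo : Xo} {b : Xu → ℝ} (a : A) (xo' : Xo) (h : Reachable M xo b)
      (hpos : 0 < M.obsProb xo' xo b a) : Reachable M xo' (M.beliefUpdate xo' xo b a)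

/-- The set `ℬ` of reachable beliefs. -/
def reachableBeliefs (M : LSIMDP Xo Xu A) : Set (Xu → ℝ) :=
  {b | ∃ xo, M.Reachable xo b}

/-- The differences `c̄(x_o, b, a) - c̄(x_o, b', a)` over reachable beliefs `b`, `b'` and all
`x_o`, `a`. -/
def costDifferences (M : LSIMDP Xo Xu A) : Set ℝ :=
  {r | ∃ b ∈ M.reachableBeliefs, ∃ b' ∈ M.reachableBeliefs, ∃ xo a,
    r = M.beliefCost xo b a - M.beliefCost xo b' a}

/-- The virtual belief model: an ordinary Markov decision process on the observable substates, with
transition probabilities `∑ p(x_o' | x_o, x_u, a) b_0(x_u)` and cost `c̄(x_o, b_0, a)`. -/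
def virtualModel (M : LSIMDP Xo Xu A) (xo0 : Xo) : ControlledChain Xo Xo A where
  init := PMF.pure xo0
  trans := fun xo a => M.prior.bind fun xu => (M.trans xo xu a).map Prod.fst
  obs := id
  cost := fun xo a => M.beliefCost xo M.initialBelief a
  discount := M.discount

end Beliefs

end LSIMDP

end

/-! Both models share the same observations and hence the same policies, so it suffices to compare
them policy by policy. When the transitions factorize, the next observation does not depend on the
hidden substate. Under a fixed policy the observed history therefore has the same law in both
models, and given that history the hidden substate is distributed as the prior pushed through the
kernels `pu` of the actions taken (`integral_localModel`).

This pushed prior is a reachable belief, because the factor `po` cancels in Bayes' rule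
(`priorPush_mem_reachableBeliefs`). At each time the two expected stage costs thus differ by the
mean of a quantity `c̄(x, b_t, a) - c̄(x, b_0, a)` lying in `costDifferences`. Summing the geometric
series and passing to infima over policies (`abs_optimalValue_sub_le`) gives the bound. -/

/-! ### Finite expectations -/

namespace PMF

/-- Expectation of a real function under a probability mass function. -/
noncomputable def expect {α : Type*} (p : PMF α) (f : α → ℝ) : ℝ := ∑' a, (p a).toReal * f a

variable {α β : Type*}

theorem expect_eq_sum [Fintype α] (p : PMF α) (f : α → ℝ) :
    p.expect f = ∑ a, (p a).toReal * f a := tsum_fintype _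

theorem integral_toMeasure_eq_expect [Finite α] [MeasurableSpace α] [MeasurableSingletonClass α]
    (p : PMF α) (f : α → ℝ) : ∫ a, f a ∂p.toMeasure = p.expect f := by
  cases nonempty_fintype α
  rw [p.integral_eq_sum, expect_eq_sum]
  simp

theorem expect_bind [Finite α] [Finite β] (p : PMF α) (k : α → PMF β) (f : β → ℝ) :
    (p.bind k).expect f = p.expect fun a => (k a).expect f := by
  cases nonempty_fintype α
  cases nonempty_fintype β
  simp only [expect_eq_sum, bind_apply, tsum_fintype, Finset.mul_sum]
  rw [Finset.sum_comm]
  refine Finset.sum_congr rfl fun b _ => ?_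
  rw [ENNReal.toReal_sum fun a _ => ENNReal.mul_ne_top (p.apply_ne_top a) ((k a).apply_ne_top b),
    Finset.sum_mul]
  simp [ENNReal.toReal_mul, mul_assoc]

theorem expect_pure [Finite α] (a : α) (f : α → ℝ) : (PMF.pure a).expect f = f a := by
  classical
  cases nonempty_fintype α
  simp only [expect_eq_sum, pure_apply]
  rw [Finset.sum_eq_single a] <;> simp +contextual

theorem expect_map [Finite α] [Finite β] (p : PMF α) (g : α → β) (f : β → ℝ) :
    (p.map g).expect f = p.expect fun a => f (g a) := by
  simp only [← bind_pure_comp, expect_bind, Function.comp_apply, expect_pure]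

theorem expect_comm [Finite α] [Finite β] (p : PMF α) (q : PMF β) (f : α → β → ℝ) :
    (p.expect fun a => q.expect (f a)) = q.expect fun b => p.expect fun a => f a b := by
  cases nonempty_fintype α
  cases nonempty_fintype β
  simp only [expect_eq_sum, Finset.mul_sum]
  rw [Finset.sum_comm]
  refine Finset.sum_congr rfl fun b _ => Finset.sum_congr rfl fun a _ => by ring

theorem sum_toReal [Fintype α] (p : PMF α) : ∑ a, (p a).toReal = 1 := by
  rw [← ENNReal.toReal_sum fun a _ => p.apply_ne_top a,
    ← tsum_fintype (L := .unconditional _), p.tsum_coe,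
    ENNReal.toReal_one]

end PMF

/-! ### Marginals of the law of a controlled chain -/

namespace ControlledChain

variable {S O A : Type*}

/-- The stages `0, …, n` of a trajectory. -/
def history (n : ℕ) (ω : ℕ → Stage S A) : Fin (n + 1) → Stage S A := fun i => ω i

theorem history_last (n : ℕ) (ω : ℕ → Stage S A) : history n ω (Fin.last n) = ω n := by
  simp [history]

theorem history_succ (n : ℕ) (ω : ℕ → Stage S A) :
    history (n + 1) ω = Fin.snoc (history n ω) (ω (n + 1)) := by
  funext i
  induction i using Fin.lastCases with
  | last => simp [history]
  | cast i => simp [history]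

theorem measurable_history (n : ℕ) : Measurable (history (S := S) (A := A) n) :=
  measurable_pi_lambda _ fun _ => measurable_pi_apply _

/-- `nextStage` as a function of the list of past stages. -/
noncomputable def nextStageLaw (K : ControlledChain S O A) (π : Policy O A) (n : ℕ)
    (z : Fin (n + 1) → Stage S A) : PMF (Stage S A) :=
  (K.trans (z (Fin.last n)).state (z (Fin.last n)).action).bind fun s' =>
    (π (n + 1) (Fin.snoc (fun i => K.obs (z i).state) (K.obs s')) (fun i => (z i).action)).map
      fun a => ⟨s', a⟩

variable [Finite S] [Finite A]

instance instIsProbabilityMeasureLaw (K : ControlledChain S O A) (π : Policy O A) :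
    IsProbabilityMeasure (K.law π) := by
  have := PMF.toMeasure.isProbabilityMeasure (K.firstStage π)
  unfold law
  infer_instance

theorem expect_firstStage (K : ControlledChain S O A) (π : Policy O A) (f : Stage S A → ℝ) :
    (K.firstStage π).expect f = K.init.expect fun s =>
      (π 0 (fun _ => K.obs s) (fun i => Fin.elim0 i)).expect fun a => f ⟨s, a⟩ := by
  simp only [firstStage, PMF.expect_bind, PMF.expect_map]

theorem expect_nextStageLaw (K : ControlledChain S O A) (π : Policy O A) (n : ℕ)
    (z : Fin (n + 1) → Stage S A) (f : Stage S A → ℝ) :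
    (K.nextStageLaw π n z).expect f =
      (K.trans (z (Fin.last n)).state (z (Fin.last n)).action).expect fun s =>
        (π (n + 1) (Fin.snoc (fun i => K.obs (z i).state) (K.obs s))
          (fun i => (z i).action)).expect fun a => f ⟨s, a⟩ := by
  simp only [nextStageLaw, PMF.expect_bind, PMF.expect_map]

theorem integrable_comp_history (K : ControlledChain S O A) (π : Policy O A) (n : ℕ)
    (F : (Fin (n + 1) → Stage S A) → ℝ) :
    Integrable (fun ω => F (history n ω)) (K.law π) :=
  (Integrable.of_finite (μ := (K.law π).map (history n)) (f := F)).comp_measurable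
    (measurable_history n)

theorem map_law_zero (K : ControlledChain S O A) (π : Policy O A) :
    (K.law π).map (fun ω => ω 0) = (K.firstStage π).toMeasure := by
  have h : (K.law π).map (Preorder.frestrictLe 0) =
      (K.firstStage π).toMeasure.map
        (MeasurableEquiv.piUnique (fun _ : Finset.Iic 0 => Stage S A)).symm := by
    unfold law Kernel.trajMeasure
    rw [Measure.map_comp _ _ (by fun_prop), Kernel.traj_map_frestrictLe,
      Kernel.partialTraj_self, Measure.id_comp]
  have h0 : (fun ω : ℕ → Stage S A => ω 0) =
      (MeasurableEquiv.piUnique (fun _ : Finset.Iic 0 => Stage S A)) ∘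
        (Preorder.frestrictLe (π := fun _ => Stage S A) 0) := by
    funext ω
    rfl
  rw [h0, ← Measure.map_map (by fun_prop) (by fun_prop), h,
    Measure.map_map (by fun_prop) (by fun_prop), MeasurableEquiv.self_comp_symm, Measure.map_id]

theorem integral_law_zero (K : ControlledChain S O A) (π : Policy O A) (f : Stage S A → ℝ) :
    ∫ ω, f (ω 0) ∂K.law π = (K.firstStage π).expect f := by
  rw [← PMF.integral_toMeasure_eq_expect, ← map_law_zero,
    integral_map (measurable_pi_apply 0).aemeasurable]
  exact (measurable_of_finite f).aestronglyMeasurable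

/-- The joint law of the history up to `n` and the next stage is the composition-product of the
history's law with `stepKernel`. This is the induction step that replaces Ionescu-Tulcea measures by
finite expectations. -/
theorem integral_law_succ (K : ControlledChain S O A) (π : Policy O A) (n : ℕ)
    (F : (Fin (n + 1 + 1) → Stage S A) → ℝ) :
    ∫ ω, F (history (n + 1) ω) ∂K.law π =
      ∫ ω, (K.nextStageLaw π n (history n ω)).expect
        (fun s => F (Fin.snoc (history n ω) s)) ∂K.law π := by
  have := PMF.toMeasure.isProbabilityMeasure (K.firstStage π)
  let G : (Finset.Iic n → Stage S A) × Stage S A → ℝ := fun p =>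
    F (Fin.snoc (fun i : Fin (n + 1) =>
      p.1 ⟨i, Finset.mem_Iic.2 (Nat.lt_succ_iff.1 i.isLt)⟩) p.2)
  have hG : Measurable G := measurable_of_finite G
  have key := Kernel.map_frestrictLe_trajMeasure_compProd_eq_map_trajMeasure
    (X := fun _ => Stage S A) (μ₀ := (K.firstStage π).toMeasure) (κ := K.stepKernel π) (a := n)
  change (K.law π).map (Preorder.frestrictLe n) ⊗ₘ K.stepKernel π n =
    (K.law π).map (fun x => (Preorder.frestrictLe n x, x (n + 1))) at key
  calc ∫ ω, F (history (n + 1) ω) ∂K.law π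
      = ∫ ω, G (Preorder.frestrictLe n ω, ω (n + 1)) ∂K.law π := by
        simp only [history_succ]
        rfl
    _ = ∫ p, G p ∂((K.law π).map (fun x => (Preorder.frestrictLe n x, x (n + 1)))) := by
        rw [integral_map (by fun_prop) hG.aestronglyMeasurable]
    _ = ∫ h, ∫ s, G (h, s) ∂K.stepKernel π n h ∂(K.law π).map (Preorder.frestrictLe n) := by
        have : IsProbabilityMeasure
            ((K.law π).map (Preorder.frestrictLe (π := fun _ => Stage S A) n)) :=
          Measure.isProbabilityMeasure_map (by fun_prop)
        rw [← key, Measure.integral_compProd .of_finite]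
    _ = ∫ ω, ∫ s, G (Preorder.frestrictLe n ω, s) ∂K.stepKernel π n (Preorder.frestrictLe n ω)
          ∂K.law π := by
        rw [integral_map (by fun_prop) (measurable_of_finite _).aestronglyMeasurable]
    _ = _ := by
        refine integral_congr_ae (.of_forall fun ω => ?_)
        -- Reindexing `frestrictLe n ω` by `Fin (n + 1)` is definitionally `history n ω`.
        exact PMF.integral_toMeasure_eq_expect
          (K.nextStage π n (Preorder.frestrictLe n ω)) (fun s => F (Fin.snoc (history n ω) s))

/-- Costs on finite spaces are bounded, so a geometric series dominates and sum and integral may be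
exchanged. -/
theorem hasSum_value (K : ControlledChain S O A) (h0 : 0 ≤ K.discount) (h1 : K.discount < 1)
    (π : Policy O A) :
    HasSum (fun t => K.discount ^ t * ∫ ω, K.cost (ω t).state (ω t).action ∂K.law π)
      (K.value π) := by
  obtain ⟨B, hB⟩ : ∃ B, ∀ z : S × A, ‖K.cost z.1 z.2‖ ≤ B := by
    obtain ⟨B, hB⟩ := (Set.finite_range fun z : S × A => ‖K.cost z.1 z.2‖).bddAbove
    exact ⟨B, fun z => hB ⟨z, rfl⟩⟩
  have hint : ∀ t, Integrable
      (fun ω => K.discount ^ t * K.cost (ω t).state (ω t).action) (K.law π) := fun t => by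
    simpa only [history_last] using K.integrable_comp_history π t fun z =>
      K.discount ^ t * K.cost (z (Fin.last t)).state (z (Fin.last t)).action
  have hsum : Summable fun t =>
      ∫ ω, ‖K.discount ^ t * K.cost (ω t).state (ω t).action‖ ∂K.law π := by
    refine Summable.of_nonneg_of_le (fun t => integral_nonneg fun ω => norm_nonneg _) (fun t => ?_)
      ((summable_geometric_of_lt_one h0 h1).mul_right B)
    calc _ ≤ ∫ _, K.discount ^ t * B ∂K.law π := by
          refine integral_mono (hint t).norm (integrable_const _) fun ω => ?_
          simp only [norm_mul, norm_pow, Real.norm_of_nonneg h0]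
          exact mul_le_mul_of_nonneg_left (hB ((ω t).state, (ω t).action)) (pow_nonneg h0 t)
      _ = _ := by simp
  have := hasSum_integral_of_summable_integral_norm hint hsum
  simp only [integral_const_mul] at this
  exact this

theorem value_nonneg (K : ControlledChain S O A) (h0 : 0 ≤ K.discount)
    (hc : ∀ s a, 0 ≤ K.cost s a) (π : Policy O A) : 0 ≤ K.value π :=
  integral_nonneg fun _ => tsum_nonneg fun t => mul_nonneg (pow_nonneg h0 t) (hc _ _)

/-- Chains with the same observations, actions and discount factor whose expected stage costs are
uniformly close under every policy have close optimal values. -/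
theorem abs_optimalValue_sub_le [Nonempty A] {S' : Type*} [Finite S'] (K : ControlledChain S O A)
    (K' : ControlledChain S' O A) (hd : K'.discount = K.discount) (h0 : 0 ≤ K.discount)
    (h1 : K.discount < 1) (hc : ∀ s a, 0 ≤ K.cost s a) (hc' : ∀ s a, 0 ≤ K'.cost s a) {D : ℝ}
    (hD : ∀ (π : Policy O A) (t : ℕ), |∫ ω, K.cost (ω t).state (ω t).action ∂K.law π -
      ∫ ω, K'.cost (ω t).state (ω t).action ∂K'.law π| ≤ D) :
    |K.optimalValue - K'.optimalValue| ≤ D / (1 - K.discount) := by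
  have hval : ∀ π : Policy O A, |K.value π - K'.value π| ≤ D / (1 - K.discount) := fun π => by
    have h := K.hasSum_value h0 h1 π
    have h' := K'.hasSum_value (hd ▸ h0) (hd ▸ h1) π
    rw [hd] at h'
    have hg := (hasSum_geometric_of_lt_one h0 h1).mul_right D
    rw [← div_eq_inv_mul] at hg
    have hle := fun t => abs_le.1 (hD π t)
    refine abs_le.2 ⟨?_, ?_⟩
    · refine hasSum_le (fun t => ?_) hg.neg (h.sub h')
      rw [← mul_sub, ← mul_neg]
      exact mul_le_mul_of_nonneg_left (hle t).1 (pow_nonneg h0 t)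
    · refine hasSum_le (fun t => ?_) (h.sub h') hg
      rw [← mul_sub]
      exact mul_le_mul_of_nonneg_left (hle t).2 (pow_nonneg h0 t)
  -- Real infima need a nonempty family bounded below; nonnegative costs give the lower bound `0`.
  have : Nonempty (Policy O A) := ⟨fun _ _ _ => PMF.pure (Classical.arbitrary A)⟩
  have hb : BddBelow (Set.range fun π : Policy O A => K.value π) :=
    ⟨0, by rintro _ ⟨π, rfl⟩; exact K.value_nonneg h0 hc π⟩
  have hb' : BddBelow (Set.range fun π : Policy O A => K'.value π) :=
    ⟨0, by rintro _ ⟨π, rfl⟩; exact K'.value_nonneg (hd ▸ h0) hc' π⟩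
  have e1 : K.optimalValue - D / (1 - K.discount) ≤ K'.optimalValue :=
    le_ciInf fun π => by
      have := ciInf_le hb π
      have := (abs_le.1 (hval π)).2
      unfold optimalValue
      linarith
  have e2 : K'.optimalValue - D / (1 - K.discount) ≤ K.optimalValue :=
    le_ciInf fun π => by
      have := ciInf_le hb' π
      have := (abs_le.1 (hval π)).1
      unfold optimalValue
      linarith
  exact abs_le.2 ⟨by linarith, by linarith⟩

end ControlledChain

/-! ### Beliefs under factorized transitions -/

namespace LSIMDP

open ControlledChain

variable {Xo Xu A : Type*}

/-- The belief about the unobservable substate at time `n` when it evolves on its own: the prior is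
pushed through the transition kernels `pu` of the actions taken before time `n`. -/
noncomputable def priorPush (M : LSIMDP Xo Xu A) (pu : Xu → A → PMF Xu) :
    (n : ℕ) → (Fin (n + 1) → Stage Xo A) → PMF Xu
  | 0, _ => M.prior
  | n + 1, z =>
    (M.priorPush pu n (Fin.init z)).bind fun xu => pu xu (z (Fin.last n).castSucc).action

theorem priorPush_snoc (M : LSIMDP Xo Xu A) (pu : Xu → A → PMF Xu) (n : ℕ)
    (z : Fin (n + 1) → Stage Xo A) (s : Stage Xo A) :
    M.priorPush pu (n + 1) (Fin.snoc z s) =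
      (M.priorPush pu n z).bind fun xu => pu xu (z (Fin.last n)).action := by
  simp [priorPush]

/-- The observed part of a history. -/
def observedHistory {n : ℕ} (z : Fin (n + 1) → Stage (Xo × Xu) A) : Fin (n + 1) → Stage Xo A :=
  fun i => ⟨(z i).state.1, (z i).action⟩

theorem observedHistory_snoc {n : ℕ} (z : Fin (n + 1) → Stage (Xo × Xu) A)
    (s : Stage (Xo × Xu) A) :
    observedHistory (Fin.snoc z s : Fin (n + 1 + 1) → Stage (Xo × Xu) A) =
      Fin.snoc (observedHistory z) ⟨s.state.1, s.action⟩ := by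
  funext i
  induction i using Fin.lastCases with
  | last => simp [observedHistory]
  | cast i => simp [observedHistory]

section Factorized

variable [Fintype Xu] {M : LSIMDP Xo Xu A} {po : Xo → A → PMF Xo} {pu : Xu → A → PMF Xu}

theorem trans_eq_bind
    (h : ∀ xo xu a xo' xu', M.trans xo xu a (xo', xu') = po xo a xo' * pu xu a xu')
    (xo : Xo) (xu : Xu) (a : A) :
    M.trans xo xu a = (po xo a).bind fun xo' => (pu xu a).map (Prod.mk xo') := by
  classical
  ext ⟨xo', xu'⟩
  rw [h, PMF.bind_apply, tsum_eq_single xo', PMF.map_apply, tsum_eq_single xu']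
  · simp
  · intro u hu
    simp [hu.symm]
  · intro o ho
    simp [PMF.map_apply, ho.symm]

theorem virtualModel_trans
    (h : ∀ xo xu a xo' xu', M.trans xo xu a (xo', xu') = po xo a xo' * pu xu a xu')
    (xo0 xo : Xo) (a : A) : (M.virtualModel xo0).trans xo a = po xo a := by
  have : ∀ xu, (M.trans xo xu a).map Prod.fst = po xo a := fun xu => by
    rw [trans_eq_bind h, PMF.map_bind]
    simp only [PMF.map_comp]
    change ((po xo a).bind fun xo' => (pu xu a).map (Function.const Xu xo')) = _
    simp only [PMF.map_const, PMF.bind_pure]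
  simp only [virtualModel, this, PMF.bind_const]

theorem sum_trans_mul
    (h : ∀ xo xu a xo' xu', M.trans xo xu a (xo', xu') = po xo a xo' * pu xu a xu')
    (b : PMF Xu) (xo xo' : Xo) (a : A) (xu' : Xu) :
    ∑ xu, (M.trans xo xu a (xo', xu')).toReal * (b xu).toReal =
      (po xo a xo').toReal * ((b.bind fun xu => pu xu a) xu').toReal := by
  rw [PMF.bind_apply, tsum_fintype, ENNReal.toReal_sum fun xu _ =>
    ENNReal.mul_ne_top (b.apply_ne_top xu) ((pu xu a).apply_ne_top xu'), Finset.mul_sum]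
  refine Finset.sum_congr rfl fun xu _ => ?_
  rw [h, ENNReal.toReal_mul, ENNReal.toReal_mul]
  ring

theorem obsProb_eq
    (h : ∀ xo xu a xo' xu', M.trans xo xu a (xo', xu') = po xo a xo' * pu xu a xu')
    (b : PMF Xu) (xo xo' : Xo) (a : A) :
    M.obsProb xo' xo (fun xu => (b xu).toReal) a = (po xo a xo').toReal := by
  rw [obsProb, Finset.sum_comm]
  simp only [sum_trans_mul h]
  rw [← Finset.mul_sum, PMF.sum_toReal, mul_one]

/-- The likelihood of the observation is the same for every hidden substate, so it cancels:
observing carries no information and the update depends on the action alone. -/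
theorem beliefUpdate_eq
    (h : ∀ xo xu a xo' xu', M.trans xo xu a (xo', xu') = po xo a xo' * pu xu a xu')
    (b : PMF Xu) (xo xo' : Xo) (a : A) (hpos : 0 < (po xo a xo').toReal) :
    M.beliefUpdate xo' xo (fun xu => (b xu).toReal) a =
      fun xu => ((b.bind fun xu => pu xu a) xu).toReal := by
  funext xu'
  rw [beliefUpdate, obsProb_eq h, sum_trans_mul h, mul_div_cancel_left₀ _ hpos.ne']

/-- The update does not depend on which observation occurs, so the observations in `z` can be
replaced by any of positive probability; `z` itself need not be a possible history. -/
theorem priorPush_mem_reachableBeliefs [Nonempty Xo]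
    (h : ∀ xo xu a xo' xu', M.trans xo xu a (xo', xu') = po xo a xo' * pu xu a xu')
    (n : ℕ) (z : Fin (n + 1) → Stage Xo A) :
    (fun xu => (M.priorPush pu n z xu).toReal) ∈ M.reachableBeliefs := by
  induction n with
  | zero => exact ⟨Classical.arbitrary Xo, .init _⟩
  | succ n ih =>
    obtain ⟨xo, hxo⟩ := ih (Fin.init z)
    let a := (z (Fin.last n).castSucc).action
    obtain ⟨xo', hxo'⟩ := (po xo a).support_nonempty
    have hpos : 0 < (po xo a xo').toReal :=
      ENNReal.toReal_pos ((PMF.mem_support_iff _ _).1 hxo') ((po xo a).apply_ne_top xo')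
    have := Reachable.step a xo' hxo (by rwa [obsProb_eq h])
    rw [beliefUpdate_eq h _ _ _ _ hpos] at this
    exact ⟨xo', this⟩

/-- Under factorized transitions, the observed history has the same law in both models, and given
it the unobservable substate is distributed according to `priorPush`. -/
theorem integral_localModel [Finite Xo] [Finite A]
    (h : ∀ xo xu a xo' xu', M.trans xo xu a (xo', xu') = po xo a xo' * pu xu a xu')
    (xo0 : Xo) (π : Policy Xo A) (n : ℕ) (F : (Fin (n + 1) → Stage Xo A) → Xu → ℝ) :
    ∫ ω, F (observedHistory (history n ω)) (ω n).state.2 ∂(M.localModel xo0).law π =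
      ∫ ω, (M.priorPush pu n (history n ω)).expect (F (history n ω))
        ∂(M.virtualModel xo0).law π := by
  induction n with
  | zero =>
    have e1 := integral_law_zero (M.localModel xo0) π fun s =>
      F (fun _ => ⟨s.state.1, s.action⟩) s.state.2
    have e2 := integral_law_zero (M.virtualModel xo0) π fun s => M.prior.expect (F fun _ => s)
    have h1 : ∀ ω : ℕ → Stage (Xo × Xu) A, observedHistory (history 0 ω) =
        fun _ => ⟨(ω 0).state.1, (ω 0).action⟩ := fun ω => by
      funext i
      fin_cases i
      rfl
    have h2 : ∀ ω : ℕ → Stage Xo A, history 0 ω = fun _ => ω 0 := fun ω => by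
      funext i
      fin_cases i
      rfl
    simp only [h1, h2, priorPush]
    rw [e1, e2, expect_firstStage, expect_firstStage]
    simp only [localModel, virtualModel, PMF.expect_map, PMF.expect_pure, id]
    -- The first action is drawn without seeing the hidden substate, so the two draws commute.
    exact PMF.expect_comm _ _ _
  | succ n ih =>
    have e1 := integral_law_succ (M.localModel xo0) π n fun z =>
      F (observedHistory z) (z (Fin.last (n + 1))).state.2
    have e2 := integral_law_succ (M.virtualModel xo0) π n fun z =>
      (M.priorPush pu (n + 1) z).expect (F z)
    simp only [history_last] at e1
    rw [e1, e2]
    -- The induction hypothesis is applied to the conditional expectation of `F` given the stages up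
    -- to `n`, with the next observation, hidden substate and action integrated out.
    have e3 := ih fun z xu =>
      (po (z (Fin.last n)).state (z (Fin.last n)).action).expect fun xo' =>
        (pu xu (z (Fin.last n)).action).expect fun xu' =>
          (π (n + 1) (Fin.snoc (fun i => (z i).state) xo') (fun i => (z i).action)).expect
            fun a' => F (Fin.snoc z ⟨xo', a'⟩) xu'
    refine Eq.trans ?_ (e3.trans ?_)
    · refine integral_congr_ae (.of_forall fun ω => ?_)
      simp only [expect_nextStageLaw, observedHistory_snoc, Fin.snoc_last]
      simp only [localModel, trans_eq_bind h, PMF.expect_bind, PMF.expect_map,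
        observedHistory, history_last]
    · refine integral_congr_ae (.of_forall fun ω => ?_)
      simp only [expect_nextStageLaw, priorPush_snoc, virtualModel_trans h, PMF.expect_bind]
      -- The old hidden substate is moved past the new observation, then both hidden draws are moved
      -- past the new action; neither draw passed depends on them.
      refine (PMF.expect_comm _ _ _).trans (congrArg _ (funext fun xo' => ?_))
      exact (congrArg _ (funext fun xu => PMF.expect_comm _ _ _)).trans (PMF.expect_comm _ _ _)

end Factorized

theorem beliefCost_eq_expect [Fintype Xu] (M : LSIMDP Xo Xu A) (xo : Xo) (b : PMF Xu) (a : A) :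
    M.beliefCost xo (fun xu => (b xu).toReal) a = b.expect fun xu => M.cost xo xu a := by
  rw [PMF.expect_eq_sum, beliefCost]

/-- Averages of costs against probability vectors stay between `0` and the largest cost. Boundedness
is what makes the real `sInf` and `sSup` genuine bounds. -/
theorem bdd_costDifferences [Finite Xo] [Fintype Xu] [Finite A] (M : LSIMDP Xo Xu A)
    (hpmf : ∀ b ∈ M.reachableBeliefs, ∃ q : PMF Xu, b = fun xu => (q xu).toReal) :
    BddBelow M.costDifferences ∧ BddAbove M.costDifferences := by
  obtain ⟨B, hB⟩ : ∃ B, ∀ z : Xo × Xu × A, M.cost z.1 z.2.1 z.2.2 ≤ B := by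
    obtain ⟨B, hB⟩ := (Set.finite_range fun z : Xo × Xu × A => M.cost z.1 z.2.1 z.2.2).bddAbove
    exact ⟨B, fun z => hB ⟨z, rfl⟩⟩
  have hbound : ∀ b ∈ M.reachableBeliefs, ∀ xo a,
      0 ≤ M.beliefCost xo b a ∧ M.beliefCost xo b a ≤ B := by
    intro b hb xo a
    obtain ⟨q, rfl⟩ := hpmf b hb
    refine ⟨Finset.sum_nonneg fun xu _ =>
      mul_nonneg ENNReal.toReal_nonneg (M.cost_nonneg _ _ _), ?_⟩
    calc M.beliefCost xo (fun xu => (q xu).toReal) a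
        ≤ ∑ xu, (q xu).toReal * B := Finset.sum_le_sum fun xu _ =>
          mul_le_mul_of_nonneg_left (hB (xo, xu, a)) ENNReal.toReal_nonneg
      _ = B := by rw [← Finset.sum_mul, q.sum_toReal, one_mul]
  constructor
  · refine ⟨-B, ?_⟩
    rintro _ ⟨b, hb, b', hb', xo, a, rfl⟩
    linarith [(hbound b hb xo a).1, (hbound b' hb' xo a).2]
  · refine ⟨B, ?_⟩
    rintro _ ⟨b, hb, b', hb', xo, a, rfl⟩
    linarith [(hbound b hb xo a).2, (hbound b' hb' xo a).1]

theorem exists_pmf_of_reachable [Fintype Xu] {M : LSIMDP Xo Xu A}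
    {po : Xo → A → PMF Xo} {pu : Xu → A → PMF Xu}
    (h : ∀ xo xu a xo' xu', M.trans xo xu a (xo', xu') = po xo a xo' * pu xu a xu')
    {xo : Xo} {b : Xu → ℝ} (hb : M.Reachable xo b) :
    ∃ q : PMF Xu, b = fun xu => (q xu).toReal := by
  induction hb with
  | init => exact ⟨M.prior, rfl⟩
  | step a xo' _ hpos ih =>
    obtain ⟨q, rfl⟩ := ih
    rw [obsProb_eq h] at hpos
    exact ⟨_, beliefUpdate_eq h _ _ _ _ hpos⟩

end LSIMDP

theorem theorem6 {Xo Xu A : Type*} [Fintype Xo] [Nonempty Xo] [Fintype Xu] [Fintype A] [Nonempty A]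
    (M : LSIMDP Xo Xu A) (hM : M.Factorizes) :
    (⨆ xo0 : Xo, |(M.localModel xo0).optimalValue - (M.virtualModel xo0).optimalValue|) ≤
      max (-(sInf M.costDifferences) / (1 - M.discount))
        (sSup M.costDifferences / (1 - M.discount)) := by
  obtain ⟨po, pu, h⟩ := hM
  obtain ⟨hbelow, habove⟩ := M.bdd_costDifferences
    fun b ⟨_, hb⟩ => LSIMDP.exists_pmf_of_reachable h hb
  -- With the common denominator outside, the numerator `max (-inf) sup` is the per-stage bound.
  rw [max_div_div_right (sub_nonneg.2 M.discount_lt_one.le)]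
  refine ciSup_le fun xo0 => ?_
  refine ControlledChain.abs_optimalValue_sub_le (M.localModel xo0) (M.virtualModel xo0)
    rfl M.discount_nonneg
    M.discount_lt_one (fun s a => M.cost_nonneg _ _ _)
    (fun s a => Finset.sum_nonneg fun xu _ =>
      mul_nonneg ENNReal.toReal_nonneg (M.cost_nonneg _ _ _)) fun π t => ?_
  have hlocal := LSIMDP.integral_localModel h xo0 π t fun z xu =>
    M.cost (z (Fin.last t)).state xu (z (Fin.last t)).action
  simp only [← LSIMDP.beliefCost_eq_expect, LSIMDP.observedHistory,
    ControlledChain.history_last] at hlocal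
  change |∫ ω, M.cost (ω t).state.1 (ω t).state.2 (ω t).action ∂(M.localModel xo0).law π -
    ∫ ω, M.beliefCost (ω t).state M.initialBelief (ω t).action ∂(M.virtualModel xo0).law π| ≤
      max (-sInf M.costDifferences) (sSup M.costDifferences)
  have i1 := (M.virtualModel xo0).integrable_comp_history π t fun z =>
    M.beliefCost (z (Fin.last t)).state (fun xu => (M.priorPush pu t z xu).toReal)
      (z (Fin.last t)).action
  have i2 := (M.virtualModel xo0).integrable_comp_history π t fun z =>
    M.beliefCost (z (Fin.last t)).state M.initialBelief (z (Fin.last t)).action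
  simp only [ControlledChain.history_last] at i1 i2
  rw [hlocal, ← integral_sub i1 i2]
  suffices hle : ∀ ω : ℕ → Stage Xo A, ‖M.beliefCost (ω t).state
      (fun xu => (M.priorPush pu t (ControlledChain.history t ω) xu).toReal) (ω t).action -
        M.beliefCost (ω t).state M.initialBelief (ω t).action‖ ≤
      max (-sInf M.costDifferences) (sSup M.costDifferences) by
    simpa using norm_integral_le_of_norm_le_const (μ := (M.virtualModel xo0).law π)
      (.of_forall hle)
  intro ω
  have hmem : M.beliefCost (ω t).state
      (fun xu => (M.priorPush pu t (ControlledChain.history t ω) xu).toReal) (ω t).action -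
        M.beliefCost (ω t).state M.initialBelief (ω t).action ∈ M.costDifferences :=
    -- The second belief is the prior, reachable at time zero.
    ⟨_, LSIMDP.priorPush_mem_reachableBeliefs h t _, _, ⟨xo0, .init _⟩, _, _, rfl⟩
  rw [Real.norm_eq_abs, abs_le]
  exact ⟨neg_le.1 ((neg_le_neg (csInf_le hbelow hmem)).trans (le_max_left _ _)),
    (le_csSup habove hmem).trans (le_max_right _ _)⟩
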